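/- Let $\mathcal H_A,\mathcal H_B,\mathcal H_C$ be finite-dimensional complex Hilbert spaces, $d_C=\dim\mathcal H_C$, and let $\rho_{ABC}$ be a state (density operator) on $\mathcal H_A\otimes\mathcal H_B\otimes\mathcal H_C$, with marginals $\rho_{AB},\rho_{BC},\rho_B,\rho_C$; put $\tau_C=I_C/d_C$. Negative powers and logarithms of positive semidefinite operators are taken on their supports, and operators are identified with their tensor products with identities. For states $\rho,\sigma$ let $$\widehat D(\rho\|\sigma)=\begin{cases}\operatorname{tr}\big[\rho\log(\rho^{1/2}\sigma^{-1}\rho^{1/2})\big] & \text{if } \ker\sigma\subseteq\ker\rho,\\ +\infty&\text{otherwise}\end{cases}$$ be the Belavkin–Staszewski (BS) entropy, and define the BS-conditional mutual informations $$\widehat I^{\mathrm{os}}_\rho(A;C|B)=\widehat D(\rho_{ABC}\|\rho_{AB}\otimes\tau_C)-\widehat D(\rho_{BC}\|\rho_B\otimes\tau_C),$$ $$\widehat I^{\mathrm{ts}}_\rho(A;C|B)=\widehat D(\rho_{ABC}\|\rho_{AB}\otimes\rho_C)-\widehat D(\rho_{BC}\|\rho_B\otimes\rho_C),$$ $$\widehat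 I^{\mathrm{rev}}_\rho(A;C|B)=\widehat D(\rho_{AB}\otimes\tau_C\|\rho_{ABC})-\widehat D(\rho_B\otimes\tau_C\|\rho_{BC}),$$ the last one under the assumption that $\widehat D(\rho_{AB}\otimes\tau_C\|\rho_{ABC})<\infty$ (which holds, for instance, if $\rho_{ABC}$ is positive definite). The state $\rho_{ABC}$ is a BS-quantum Markov chain (BS-QMC) if its BS-conditional mutual information is zero. Let $$\Phi_{B\to AB}(X)=\rho_B^{1/2}\big(\rho_B^{-1/2}\rho_{AB}\rho_B^{-1/2}\big)^{1/2}\rho_B^{-1/2}\,X\,\rho_B^{-1/2}\big(\rho_B^{-1/2}\rho_{AB}\rho_B^{-1/2}\big)^{1/2}\rho_B^{1/2}.$$ Then the linear map $\Phi_{B\to AB}$ is completely positive, and $\rho_{ABC}$ is a BS-QMC if and only if $(\Phi_{B\to AB}\otimes\mathrm{id}_C)(\rho_{BC})=\rho_{ABC}$. More precisely, this equivalence holds for each of the conditions $\widehat I^{\mathrm{os}}_\rho(A;C|B)=0$ and $\widehat I^{\mathrm{ts}}_\rho(A;C|B)=0$, and also for $\widehat I^{\mathrm{rev}}_\rho(A;C|B)=0$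 whenever $\widehat D(\rho_{AB}\otimes\tau_C\|\rho_{ABC})<\infty$. -/

import Mathlib

open scoped Kronecker ComplexOrder

noncomputable section

namespace BSChain

/-- A quantum state (density matrix) on the Hilbert space with orthonormal basis indexed by `n`. -/
def IsState {n : Type*} [Fintype n] (ρ : Matrix n n ℂ) : Prop :=
  ρ.PosSemidef ∧ ρ.trace = 1

/-- The real power `M ^ r` of a positive semidefinite matrix, through the functional calculus.
Since `0 ^ r = 0` for real `r ≠ 0`, negative powers are taken on the support of `M`
(and vanish on the kernel), so they are the usual ones when `M` is invertible. -/
def mpow {n : Type*} [Fintype n] [DecidableEq n] (M : Matrix n n ℂ) (r : ℝ) : Matrix n n ℂ :=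
  cfc (fun x : ℝ => x ^ r) M

/-- The logarithm of a positive semidefinite matrix, taken on its support. -/
def mlog {n : Type*} [Fintype n] [DecidableEq n] (M : Matrix n n ℂ) : Matrix n n ℂ :=
  cfc Real.log M

open Classical in
/-- The Belavkin-Staszewski entropy
`D(ρ ‖ σ) = tr [ρ log (ρ ^ (1/2) σ ^ (-1) ρ ^ (1/2))]` if `ker σ ⊆ ker ρ`, and `+∞` otherwise. -/
def bsEntropy {n : Type*} [Fintype n] [DecidableEq n] (ρ σ : Matrix n n ℂ) : EReal :=
  if LinearMap.ker σ.mulVecLin ≤ LinearMap.ker ρ.mulVecLin then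
    (((ρ * mlog (mpow ρ (1 / 2) * mpow σ (-1) * mpow ρ (1 / 2))).trace.re : ℝ) : EReal)
  else ⊤

section Marginals

variable {a b c : Type*}

/-- The marginal `ρ_AB = tr_C ρ_ABC`. -/
def margAB [Fintype c] (ρ : Matrix ((a × b) × c) ((a × b) × c) ℂ) : Matrix (a × b) (a × b) ℂ :=
  Matrix.of fun i j => ∑ z, ρ (i, z) (j, z)

/-- The marginal `ρ_BC = tr_A ρ_ABC`. -/
def margBC [Fintype a] (ρ : Matrix ((a × b) × c) ((a × b) × c) ℂ) : Matrix (b × c) (b × c) ℂ :=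
  Matrix.of fun i j => ∑ x, ρ ((x, i.1), i.2) ((x, j.1), j.2)

/-- The marginal `ρ_B = tr_AC ρ_ABC`. -/
def margB [Fintype a] [Fintype c] (ρ : Matrix ((a × b) × c) ((a × b) × c) ℂ) : Matrix b b ℂ :=
  Matrix.of fun i j => ∑ x, ∑ z, ρ ((x, i), z) ((x, j), z)

/-- The marginal `ρ_C = tr_AB ρ_ABC`. -/
def margC [Fintype a] [Fintype b] (ρ : Matrix ((a × b) × c) ((a × b) × c) ℂ) : Matrix c c ℂ :=
  Matrix.of fun i j => ∑ x, ∑ y, ρ ((x, y), i) ((x, y), j)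

end Marginals

/-- The maximally mixed state. -/
def maxMixed (n : Type*) [Fintype n] [DecidableEq n] : Matrix n n ℂ :=
  (Fintype.card n : ℂ)⁻¹ • (1 : Matrix n n ℂ)

/-- The three variants (one-sided, two-sided, reversed) of the BS-conditional mutual
information. -/
inductive Variant
  | os
  | ts
  | rev

section

variable {a b c : Type*} [Fintype a] [Fintype b] [Fintype c]
  [DecidableEq a] [DecidableEq b] [DecidableEq c]

/-- The BS-conditional mutual information of `ρ_ABC` between `A` and `C` conditioned on `B`. -/
def bsCMI (ρ : Matrix ((a × b) × c) ((a × b) × c) ℂ) : Variant → EReal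
  | .os => bsEntropy ρ (margAB ρ ⊗ₖ maxMixed c) - bsEntropy (margBC ρ) (margB ρ ⊗ₖ maxMixed c)
  | .ts => bsEntropy ρ (margAB ρ ⊗ₖ margC ρ) - bsEntropy (margBC ρ) (margB ρ ⊗ₖ margC ρ)
  | .rev => bsEntropy (margAB ρ ⊗ₖ maxMixed c) ρ - bsEntropy (margB ρ ⊗ₖ maxMixed c) (margBC ρ)

/-- `ρ_ABC` is a BS-quantum Markov chain: its BS-conditional mutual information (in the
variant `x`) vanishes. -/
def IsBSQMC (x : Variant) (ρ : Matrix ((a × b) × c) ((a × b) × c) ℂ) : Prop :=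
  bsCMI ρ x = 0

/-- The operator `I_A ⊗ X_B`. -/
def ampB (X : Matrix b b ℂ) : Matrix (a × b) (a × b) ℂ :=
  (1 : Matrix a a ℂ) ⊗ₖ X

/-- The operator `(ρ_B ^ (-1/2) ρ_AB ρ_B ^ (-1/2)) ^ (1/2)` on `AB`. -/
def midAB (ρ : Matrix ((a × b) × c) ((a × b) × c) ℂ) : Matrix (a × b) (a × b) ℂ :=
  mpow (ampB (mpow (margB ρ) (-1 / 2)) * margAB ρ * ampB (mpow (margB ρ) (-1 / 2))) (1 / 2)

/-- The map `Φ_{B → AB}` associated with `ρ_ABC`; operators on `B` are identified with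
operators on `AB` by tensoring with the identity of `A`. -/
def recoveryMap (ρ : Matrix ((a × b) × c) ((a × b) × c) ℂ) :
    Matrix b b ℂ →ₗ[ℂ] Matrix (a × b) (a × b) ℂ where
  toFun X :=
    ampB (mpow (margB ρ) (1 / 2)) * midAB ρ * ampB (mpow (margB ρ) (-1 / 2)) * ampB X *
      ampB (mpow (margB ρ) (-1 / 2)) * midAB ρ * ampB (mpow (margB ρ) (1 / 2))
  map_add' X Y := by
    simp only [ampB, Matrix.kronecker_add, mul_add, add_mul]
  map_smul' r X := by
    simp only [ampB, Matrix.kronecker_smul, Matrix.mul_smul, Matrix.smul_mul, RingHom.id_apply]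

end

/-- The map `Φ ⊗ id` for a linear map `Φ` between matrix algebras: `Φ` is applied to each of
the blocks with respect to the second tensor factor. -/
def tensorId {m n k : Type*} (Φ : Matrix m m ℂ →ₗ[ℂ] Matrix n n ℂ)
    (X : Matrix (m × k) (m × k) ℂ) : Matrix (n × k) (n × k) ℂ :=
  Matrix.of fun i j => Φ (Matrix.of fun p q => X (p, i.2) (q, j.2)) i.1 j.1

/-- Complete positivity: `Φ ⊗ id_k` preserves positive semidefiniteness for all `k`. -/
def IsCompletelyPositive {m n : Type*} [Fintype m] [Fintype n]
    (Φ : Matrix m m ℂ →ₗ[ℂ] Matrix n n ℂ) : Prop :=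
  ∀ (k : ℕ) (X : Matrix (m × Fin k) (m × Fin k) ℂ), X.PosSemidef → (tensorId Φ X).PosSemidef

end BSChain

end

/-!
Let `T` be the partial trace over `A` and `i` the amplification `X ↦ 1 ⊗ X` from `BC` to `ABC`. Each
of the three conditional mutual informations is a difference `D(ρ ‖ σ) - D(T ρ ‖ T σ)` with `ρ, σ`
the two operators `ρ_ABC` and `ρ_AB ⊗ ω` in one order or the other, where `ω` is `τ_C` or `ρ_C`. Its
vanishing is therefore the case of equality in the data processing inequality.

*Equality in data processing* (`IsPartialTrace.bsEntropy_sub_eq_zero_iff`). Put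
`M = ρ^(1/2) σ⁻¹ ρ^(1/2)`. For `t > 0` the operator `ρ^(1/2) (M + t)⁻¹ ρ^(1/2)` is a multiple of the
parallel sum of `ρ` and `t σ`, and `t` times it is the minimum over `Z` of the quadratic form
`t Zᴴ σ Z + (1 - Z)ᴴ ρ (1 - Z)`. Inserting `Z = i Z'`, with `Z'` the minimizer for `T ρ, T σ`, shows
that `tr ρ (M + t)⁻¹` increases under `T`, and expresses the defect as the trace of a positive
semidefinite operator (`IsPartialTrace.trace_parSum_sub`). The logarithm is recovered from the
resolvents: the difference of the functions `t ↦ tr ρ log (M + t)` for `ρ, σ` and for `T ρ, T σ` is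
antitone on `[0, ∞)` and tends to `0` at infinity (`sum_mul_log_eq_iff`), so that equality of the
entropies means that the defect is zero for all `t > 0`. This says that `ρ = G i(T ρ)` and
`σ = G i(T σ)` for a common matrix `G` (`IsSaturated`), a condition symmetric in `ρ` and `σ`, which
is why the reversed variant leads to the same condition.

*The product form.* For the pair `ρ_ABC, ρ_AB ⊗ ω` the condition amounts to
`ρ_ABC = ρ_AB ρ_B⁻¹ ρ_BC`, whatever `ω` is (`isSaturated_iff_isProductChain`).

*The recovery map* (`isProductChain_iff`). Let `S² = ρ_B^(-1/2) ρ_AB ρ_B^(-1/2)` with `S ≥ 0` and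
`Y = ρ_B^(-1/2) ρ_BC ρ_B^(-1/2)`. The product form reads `ρ_ABC = ρ_B^(1/2) S² Y ρ_B^(1/2)`, and the
recovery identity reads `ρ_ABC = ρ_B^(1/2) S Y S ρ_B^(1/2)`. They agree if `S` commutes with `Y`.
The former makes `S² Y` Hermitian, so that `S²` and hence `S` commutes with `Y`. The latter makes
`Y` a fixed point of `Z ↦ T (S Z S)`, which forces the commutator of `S` and `Y` to have
Hilbert-Schmidt norm zero (`IsPartialTrace.commute_of_fixed`). Complete positivity is visible from
the form `X ↦ V X Vᴴ` of the map.
-/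

namespace BSChain
open Matrix Filter Topology

/-! ### Powers and support projections of positive semidefinite matrices -/

section FunctionalCalculus

variable {n : Type*} [Fintype n] [DecidableEq n] {A B : Matrix n n ℂ}

/-- The spectrum is finite, so the functional calculus applies to arbitrary functions. -/
lemma continuousOn_spectrum (f : ℝ → ℝ) (A : Matrix n n ℂ) :
    ContinuousOn f (spectrum ℝ A) :=
  (Matrix.finite_real_spectrum (A := A)).continuousOn f

lemma nonneg_of_mem_spectrum (hA : A.PosSemidef) {x : ℝ} (hx : x ∈ spectrum ℝ A) : 0 ≤ x := by
  rw [hA.isHermitian.spectrum_real_eq_range_eigenvalues] at hx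
  obtain ⟨i, rfl⟩ := hx
  exact hA.eigenvalues_nonneg i

lemma cfc_mul_cfc (f g : ℝ → ℝ) (A : Matrix n n ℂ) :
    cfc f A * cfc g A = cfc (fun x => f x * g x) A :=
  (cfc_mul f g A (continuousOn_spectrum f A) (continuousOn_spectrum g A)).symm

lemma isHermitian_cfc (f : ℝ → ℝ) (A : Matrix n n ℂ) : (cfc f A).IsHermitian :=
  cfc_predicate f A

lemma isHermitian_mpow (A : Matrix n n ℂ) (r : ℝ) : (mpow A r).IsHermitian :=
  isHermitian_cfc _ A

/-- The orthogonal projection onto the support of a positive semidefinite matrix. -/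
noncomputable def suppProj (A : Matrix n n ℂ) : Matrix n n ℂ :=
  cfc (fun x : ℝ => if x = 0 then 0 else 1) A

lemma isHermitian_suppProj (A : Matrix n n ℂ) : (suppProj A).IsHermitian :=
  isHermitian_cfc _ A

lemma mpow_mul_mpow (hA : A.PosSemidef) {r s : ℝ} (hr : r ≠ 0) (hrs : r + s ≠ 0) :
    mpow A r * mpow A s = mpow A (r + s) := by
  unfold mpow
  rw [cfc_mul_cfc]
  refine cfc_congr fun x hx => ?_
  rcases (nonneg_of_mem_spectrum hA hx).eq_or_lt with h | h
  · simp [← h, Real.zero_rpow hr, Real.zero_rpow hrs]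
  · exact (Real.rpow_add h r s).symm

lemma mpow_mul_mpow_neg (hA : A.PosSemidef) {r s : ℝ} (hr : r ≠ 0) (hrs : r + s = 0) :
    mpow A r * mpow A s = suppProj A := by
  unfold mpow suppProj
  rw [cfc_mul_cfc]
  refine cfc_congr fun x hx => ?_
  rcases (nonneg_of_mem_spectrum hA hx).eq_or_lt with h | h
  · simp [← h, Real.zero_rpow hr]
  · simp [← Real.rpow_add h r s, hrs, h.ne']

lemma mpow_one (hA : A.PosSemidef) : mpow A 1 = A := by
  have h : (fun x : ℝ => x ^ (1 : ℝ)) = id := by ext x; simp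
  rw [mpow, h]
  exact cfc_id ℝ A hA.isHermitian

lemma mpow_mul_suppProj (A : Matrix n n ℂ) {r : ℝ} (hr : r ≠ 0) :
    mpow A r * suppProj A = mpow A r := by
  unfold mpow suppProj
  rw [cfc_mul_cfc]
  refine cfc_congr fun x _ => ?_
  by_cases h : x = 0 <;> simp [h, Real.zero_rpow hr]

lemma suppProj_mul_mpow (A : Matrix n n ℂ) {r : ℝ} (hr : r ≠ 0) :
    suppProj A * mpow A r = mpow A r := by
  unfold mpow suppProj
  rw [cfc_mul_cfc]
  refine cfc_congr fun x _ => ?_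
  by_cases h : x = 0 <;> simp [h, Real.zero_rpow hr]

lemma mul_suppProj_self (hA : A.PosSemidef) : A * suppProj A = A := by
  simpa [mpow_one hA] using mpow_mul_suppProj A (one_ne_zero (α := ℝ))

lemma mpow_half_mul_self (hA : A.PosSemidef) : mpow A (1 / 2) * mpow A (1 / 2) = A := by
  rw [mpow_mul_mpow hA (by norm_num) (by norm_num), add_halves, mpow_one hA]

lemma mpow_neg_half_mul_self (hA : A.PosSemidef) :
    mpow A (-1 / 2) * mpow A (-1 / 2) = mpow A (-1) := by
  rw [mpow_mul_mpow hA (by norm_num) (by norm_num)]; norm_num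

lemma mpow_half_mul_neg_half (hA : A.PosSemidef) :
    mpow A (1 / 2) * mpow A (-1 / 2) = suppProj A :=
  mpow_mul_mpow_neg hA (by norm_num) (by norm_num)

lemma mpow_neg_half_mul_half (hA : A.PosSemidef) :
    mpow A (-1 / 2) * mpow A (1 / 2) = suppProj A :=
  mpow_mul_mpow_neg hA (by norm_num) (by norm_num)

lemma mul_mpow_neg_one (hA : A.PosSemidef) : A * mpow A (-1) = suppProj A := by
  simpa [mpow_one hA] using mpow_mul_mpow_neg hA (one_ne_zero (α := ℝ)) (add_neg_cancel 1)

lemma mpow_neg_one_mul (hA : A.PosSemidef) : mpow A (-1) * A = suppProj A := by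
  simpa [mpow_one hA] using
    mpow_mul_mpow_neg hA (neg_ne_zero.2 (one_ne_zero (α := ℝ))) (neg_add_cancel 1)

/-- `ker A ≤ ker B` holds exactly when `B` lives on the support of `A`. -/
lemma ker_le_ker_iff (hA : A.PosSemidef) :
    LinearMap.ker A.mulVecLin ≤ LinearMap.ker B.mulVecLin ↔ B * suppProj A = B := by
  constructor
  · intro h
    refine Matrix.ext_of_mulVec_single fun i => ?_
    have h1 : (1 - suppProj A) *ᵥ (Pi.single i 1) ∈ LinearMap.ker A.mulVecLin := by
      rw [LinearMap.mem_ker, mulVecLin_apply, mulVec_mulVec, mul_sub, mul_suppProj_self hA,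
        mul_one, sub_self, zero_mulVec]
    have h2 := h h1
    rw [LinearMap.mem_ker, mulVecLin_apply, mulVec_mulVec, mul_sub, mul_one, sub_mulVec,
      sub_eq_zero] at h2
    exact h2.symm
  · intro h x hx
    rw [LinearMap.mem_ker, mulVecLin_apply] at hx ⊢
    rw [← h, ← mpow_neg_one_mul hA, ← mul_assoc, ← mulVec_mulVec, hx, mulVec_zero]

lemma mul_suppProj_of_eq_mul (hA : A.PosSemidef) {W : Matrix n n ℂ} (h : B = W * A) :
    B * suppProj A = B := by
  rw [h, mul_assoc, mul_suppProj_self hA]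

lemma suppProj_mul_of_mul_suppProj (hB : B.IsHermitian) (h : B * suppProj A = B) :
    suppProj A * B = B := by
  simpa [conjTranspose_mul, hB.eq, (isHermitian_suppProj A).eq] using congrArg (·ᴴ) h

lemma commute_mpow {r : ℝ} (h : Commute A B) : Commute (mpow A r) B :=
  h.cfc_real _

/-- For a positive semidefinite `A` and `B` living on its support, `f ↦ tr (B f(A))` is integration
against a signed measure on `[0, ∞)` with finitely many atoms and no atom at `0`. -/
lemma exists_weights (hA : A.PosSemidef) (h : B * suppProj A = B) :
    ∃ w m : n → ℝ, (∀ i, 0 ≤ m i) ∧ (∀ i, m i = 0 → w i = 0) ∧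
      ∀ f : ℝ → ℝ, (B * cfc f A).trace.re = ∑ i, w i * f (m i) := by
  set U : Matrix n n ℂ := (hA.isHermitian.eigenvectorUnitary : Matrix n n ℂ) with hU
  set m := hA.isHermitian.eigenvalues
  -- The factor `if m i = 0 then 0 else 1` comes from `B = B * suppProj A`.
  refine ⟨fun i => (if m i = 0 then 0 else 1) * ((star U * B * U) i i).re, m,
    hA.eigenvalues_nonneg, fun i hi => by simp [hi], fun f => ?_⟩
  have h1 : B * cfc f A = B * cfc (fun x : ℝ => (if x = 0 then 0 else 1) * f x) A := by
    conv_lhs => rw [← h, suppProj, mul_assoc, cfc_mul_cfc]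
  rw [h1, hA.isHermitian.cfc_eq, IsHermitian.cfc, Unitary.conjStarAlgAut_apply, ← hU,
    ← mul_assoc, ← mul_assoc, trace_mul_comm, ← mul_assoc, ← mul_assoc, trace]
  rw [Complex.re_sum]
  refine Finset.sum_congr rfl fun i _ => ?_
  simp only [diag_apply, mul_diagonal, Function.comp_apply]
  by_cases hi : m i = 0
  · simp [hi, m]
  · simp [hi, m]

end FunctionalCalculus

/-! ### Logarithmic sums and resolvents -/

section Scalar

/-- The scalar form of the equality analysis of data processing for `log`. The difference of the
two sums `∑ w log (m + t)` is antitone in `t`, and tends to `0` as `t → ∞`; it therefore vanishes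
at `t = 0` exactly when its derivative vanishes identically. -/
lemma sum_mul_log_eq_iff {ι κ : Type*} [Fintype ι] [Fintype κ] {w m : ι → ℝ} {v p : κ → ℝ}
    (hm : ∀ i, 0 ≤ m i) (hw : ∀ i, m i = 0 → w i = 0)
    (hp : ∀ j, 0 ≤ p j) (hv : ∀ j, p j = 0 → v j = 0)
    (hsum : ∑ i, w i = ∑ j, v j)
    (hle : ∀ t : ℝ, 0 < t → ∑ i, w i * (m i + t)⁻¹ ≤ ∑ j, v j * (p j + t)⁻¹) :
    ∑ i, w i * Real.log (m i) = ∑ j, v j * Real.log (p j) ↔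
      ∀ t : ℝ, 0 < t → ∑ i, w i * (m i + t)⁻¹ = ∑ j, v j * (p j + t)⁻¹ := by
  set H : ℝ → ℝ := fun t => ∑ i, w i * Real.log (m i + t) - ∑ j, v j * Real.log (p j + t) with hH
  have hcont_aux : ∀ a b : ℝ, 0 ≤ b → (b = 0 → a = 0) →
      ContinuousOn (fun t => a * Real.log (b + t)) (Set.Ici 0) := by
    intro a b hb hab t ht
    rcases hb.eq_or_lt with h | h
    · simpa [hab h.symm] using continuousWithinAt_const
    · have : b + t ≠ 0 := by have := Set.mem_Ici.1 ht; positivity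
      exact (((continuousAt_const.add continuousAt_id).log this).const_mul a).continuousWithinAt
  have hcont : ContinuousOn H (Set.Ici 0) :=
    (continuousOn_finsetSum _ fun i _ => hcont_aux _ _ (hm i) (hw i)).sub
      (continuousOn_finsetSum _ fun j _ => hcont_aux _ _ (hp j) (hv j))
  have hder_aux : ∀ a b t : ℝ, 0 ≤ b → 0 < t →
      HasDerivAt (fun t => a * Real.log (b + t)) (a * (b + t)⁻¹) t := by
    intro a b t hb ht
    have h := (((hasDerivAt_id t).const_add b).log (by simp only [id]; positivity)).const_mul a
    simpa using h
  have hder : ∀ t, 0 < t →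
      HasDerivAt H (∑ i, w i * (m i + t)⁻¹ - ∑ j, v j * (p j + t)⁻¹) t := fun t ht =>
    (HasDerivAt.fun_sum fun i _ => hder_aux _ _ t (hm i) ht).sub
      (HasDerivAt.fun_sum fun j _ => hder_aux _ _ t (hp j) ht)
  have hlim_aux : ∀ b : ℝ, 0 ≤ b →
      Tendsto (fun t => Real.log (b + t) - Real.log t) atTop (𝓝 0) := by
    intro b _
    simpa [add_comm] using Real.tendsto_log_comp_add_sub_log b
  have hlim : Tendsto H atTop (𝓝 0) := by
    have h1 : Tendsto (fun t => ∑ i, w i * (Real.log (m i + t) - Real.log t) -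
        ∑ j, v j * (Real.log (p j + t) - Real.log t)) atTop
        (𝓝 (∑ i, w i * 0 - ∑ j, v j * 0)) :=
      (tendsto_finsetSum _ fun i _ => (hlim_aux _ (hm i)).const_mul _).sub
        (tendsto_finsetSum _ fun j _ => (hlim_aux _ (hp j)).const_mul _)
    simp only [mul_zero, Finset.sum_const_zero, sub_zero] at h1
    refine h1.congr fun t => ?_
    simp only [hH, mul_sub, Finset.sum_sub_distrib, ← Finset.sum_mul, hsum]
    ring
  have hH0 : H 0 = 0 ↔
      ∑ i, w i * Real.log (m i) = ∑ j, v j * Real.log (p j) := by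
    simp [hH, sub_eq_zero]
  rw [← hH0]
  have hanti : AntitoneOn H (Set.Ici 0) := by
    refine antitoneOn_of_deriv_nonpos (convex_Ici 0) hcont ?_ ?_
    · intro t ht
      rw [interior_Ici] at ht
      exact (hder t ht).differentiableAt.differentiableWithinAt
    · intro t ht
      rw [interior_Ici] at ht
      rw [(hder t ht).deriv]
      exact sub_nonpos.2 (hle t ht)
  have hnonneg : ∀ t, 0 ≤ t → 0 ≤ H t := fun t ht =>
    le_of_tendsto hlim <| (eventually_ge_atTop t).mono fun s hs =>
      hanti (Set.mem_Ici.2 ht) (Set.mem_Ici.2 (ht.trans hs)) hs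
  constructor
  · intro h0 t ht
    have hzero : H =ᶠ[𝓝 t] fun _ => 0 := by
      filter_upwards [lt_mem_nhds ht] with s hs
      refine le_antisymm ?_ (hnonneg s hs.le)
      rw [← h0]
      exact hanti (Set.mem_Ici.2 le_rfl) (Set.mem_Ici.2 hs.le) hs.le
    exact sub_eq_zero.1
      ((hder t ht).unique ((hasDerivAt_const t (0 : ℝ)).congr_of_eventuallyEq hzero))
  · intro h
    have hmono : MonotoneOn H (Set.Ici 0) := by
      refine monotoneOn_of_deriv_nonneg (convex_Ici 0) hcont ?_ ?_
      · intro t ht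
        rw [interior_Ici] at ht
        exact (hder t ht).differentiableAt.differentiableWithinAt
      · intro t ht
        rw [interior_Ici] at ht
        rw [(hder t ht).deriv]
        exact (sub_eq_zero.2 (h t ht)).ge
    refine le_antisymm ?_ (hnonneg 0 le_rfl)
    exact ge_of_tendsto hlim <| (eventually_ge_atTop 0).mono fun s hs =>
      hmono (Set.mem_Ici.2 le_rfl) (Set.mem_Ici.2 hs) hs

end Scalar

/-! ### Partial traces as adjoints of amplifications -/

section Amplification

variable {n m : Type*} [Fintype n] [DecidableEq n] [Fintype m] [DecidableEq m]

lemma mul_eq_zero_of_trace_conj_eq_zero {A Z : Matrix n n ℂ} (hA : A.PosSemidef)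
    (h : (Zᴴ * A * Z).trace = 0) : A * Z = 0 := by
  have h1 := mpow_half_mul_self hA
  have h2 := (isHermitian_mpow A (1 / 2)).eq
  set s := mpow A (1 / 2)
  have h3 : (s * Z)ᴴ * (s * Z) = Zᴴ * A * Z := by
    rw [conjTranspose_mul, h2, ← h1]; simp only [mul_assoc]
  rw [← h3, trace_conjTranspose_mul_self_eq_zero_iff] at h
  rw [← h1, mul_assoc, h, mul_zero]

/-- `T` is the partial trace that goes with an amplification `i` such as `X ↦ X ⊗ 1`: the adjoint
of `i` with respect to the trace pairing. -/
structure IsPartialTrace (i : Matrix m m ℂ →⋆ₐ[ℂ] Matrix n n ℂ)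
    (T : Matrix n n ℂ → Matrix m m ℂ) : Prop where
  trace_mul : ∀ X Z, (X * i Z).trace = (T X * Z).trace

namespace IsPartialTrace

variable {i : Matrix m m ℂ →⋆ₐ[ℂ] Matrix n n ℂ} {T : Matrix n n ℂ → Matrix m m ℂ}

lemma map_conjTranspose (i : Matrix m m ℂ →⋆ₐ[ℂ] Matrix n n ℂ) (Z : Matrix m m ℂ) :
    (i Z)ᴴ = i Zᴴ :=
  (map_star i Z).symm

lemma add (hT : IsPartialTrace i T) (X Y : Matrix n n ℂ) : T (X + Y) = T X + T Y :=
  Matrix.ext_iff_trace_mul_right.2 fun Z => by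
    rw [← hT.trace_mul, add_mul, trace_add, hT.trace_mul, hT.trace_mul, add_mul, trace_add]

lemma mul_right (hT : IsPartialTrace i T) (X : Matrix n n ℂ) (Z : Matrix m m ℂ) :
    T (X * i Z) = T X * Z :=
  Matrix.ext_iff_trace_mul_right.2 fun W => by
    rw [← hT.trace_mul, mul_assoc, ← map_mul, hT.trace_mul, mul_assoc]

lemma mul_left (hT : IsPartialTrace i T) (Z : Matrix m m ℂ) (X : Matrix n n ℂ) :
    T (i Z * X) = Z * T X :=
  Matrix.ext_iff_trace_mul_right.2 fun W => by
    rw [← hT.trace_mul, mul_assoc, trace_mul_comm, mul_assoc, ← map_mul, hT.trace_mul,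
      ← mul_assoc, trace_mul_comm, ← mul_assoc]

lemma trace (hT : IsPartialTrace i T) (X : Matrix n n ℂ) : (T X).trace = X.trace := by
  have := hT.trace_mul X 1
  simpa using this.symm

lemma posSemidef (hT : IsPartialTrace i T) {X : Matrix n n ℂ} (hX : X.PosSemidef) :
    (T X).PosSemidef := by
  refine .of_dotProduct_mulVec_nonneg ?_ fun x => ?_
  · refine Matrix.ext_iff_trace_mul_right.2 fun Z => ?_
    have h := hT.trace_mul X Zᴴ
    rw [← map_conjTranspose] at h
    have h' := congrArg star h
    rw [← trace_conjTranspose, ← trace_conjTranspose, conjTranspose_mul, conjTranspose_mul,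
      conjTranspose_conjTranspose, conjTranspose_conjTranspose, hX.isHermitian.eq,
      trace_mul_comm, hT.trace_mul, trace_mul_comm Z] at h'
    exact h'.symm
  · have h1 : star x ⬝ᵥ (T X *ᵥ x) = (T X * vecMulVec x (star x)).trace := by
      rw [mul_vecMulVec, trace_vecMulVec, dotProduct_comm]
    obtain ⟨W, hW⟩ : ∃ W : Matrix m m ℂ, vecMulVec x (star x) = W * Wᴴ := by
      have hP := posSemidef_vecMulVec_self_star x
      refine ⟨mpow (vecMulVec x (star x)) (1 / 2), ?_⟩
      rw [(isHermitian_mpow _ _).eq, mpow_half_mul_self hP]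
    rw [h1, ← hT.trace_mul, hW, map_mul, ← mul_assoc, trace_mul_comm, ← mul_assoc,
      ← map_conjTranspose]
    exact (hX.conjTranspose_mul_mul_same (i W)).trace_nonneg

lemma trace_conj (hT : IsPartialTrace i T) (X : Matrix n n ℂ) (Z : Matrix m m ℂ) :
    ((i Z)ᴴ * X * i Z).trace = (Zᴴ * T X * Z).trace := by
  rw [map_conjTranspose, hT.trace_mul, hT.mul_left]

/-- Faithfulness of the partial trace: `tr (i(Z)ᴴ X i(Z)) = tr (Zᴴ T(X) Z)` for `X ≥ 0`, so the
vanishing of `T X * Z` passes to `X * i Z`. -/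
lemma mul_map_eq_zero (hT : IsPartialTrace i T) {X : Matrix n n ℂ} (hX : X.PosSemidef)
    {Z : Matrix m m ℂ} (h : T X * Z = 0) : X * i Z = 0 := by
  refine mul_eq_zero_of_trace_conj_eq_zero hX ?_
  rw [hT.trace_conj, mul_assoc, h, mul_zero, trace_zero]

lemma mul_map_suppProj (hT : IsPartialTrace i T) {X : Matrix n n ℂ} (hX : X.PosSemidef) :
    X * i (suppProj (T X)) = X := by
  have h := hT.mul_map_eq_zero hX (Z := 1 - suppProj (T X))
    (by rw [mul_sub, mul_suppProj_self (hT.posSemidef hX), mul_one, sub_self])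
  rw [map_sub, map_one, mul_sub, mul_one, sub_eq_zero] at h
  exact h.symm

lemma map_suppProj_mul (hT : IsPartialTrace i T) {X : Matrix n n ℂ} (hX : X.PosSemidef) :
    i (suppProj (T X)) * X = X := by
  have h := congrArg conjTranspose (hT.mul_map_suppProj hX)
  rwa [conjTranspose_mul, map_conjTranspose, (isHermitian_suppProj _).eq,
    hX.isHermitian.eq] at h

/-- Inclusion of supports is inherited by the partial traces. -/
lemma mul_suppProj (hT : IsPartialTrace i T) {ρ σ : Matrix n n ℂ}
    (hσ : σ.PosSemidef) (h : ρ * suppProj σ = ρ) : T ρ * suppProj (T σ) = T ρ := by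
  rw [← hT.mul_right]
  congr 1
  have h1 : ρ = ρ * mpow σ (-1) * σ := by rw [mul_assoc, mpow_neg_one_mul hσ, h]
  rw [h1, mul_assoc, hT.mul_map_suppProj hσ]

end IsPartialTrace

end Amplification

/-! ### Parallel sums -/

section ParallelSum

variable {n : Type*} [Fintype n] [DecidableEq n] {ρ σ : Matrix n n ℂ}

/-- The operator `ρ ^ (1/2) σ⁻¹ ρ ^ (1/2)` whose logarithm enters the Belavkin-Staszewski
entropy. -/
noncomputable def relOp (ρ σ : Matrix n n ℂ) : Matrix n n ℂ :=
  mpow ρ (1 / 2) * mpow σ (-1) * mpow ρ (1 / 2)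

/-- A multiple of the parallel sum of `ρ` and `t σ`: for invertible `ρ` and `σ` this is
`(σ⁻¹ + t ρ⁻¹)⁻¹`. -/
noncomputable def parSum (ρ σ : Matrix n n ℂ) (t : ℝ) : Matrix n n ℂ :=
  mpow ρ (1 / 2) * cfc (fun x : ℝ => (x + t)⁻¹) (relOp ρ σ) * mpow ρ (1 / 2)

/-- The minimizer `Z` of the quadratic form `tr (t Zᴴ σ Z + (1 - Z)ᴴ ρ (1 - Z))`. -/
noncomputable def parMin (ρ σ : Matrix n n ℂ) (t : ℝ) : Matrix n n ℂ :=
  mpow σ (-1) * parSum ρ σ t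

lemma relOp_eq (hσ : σ.PosSemidef) : relOp ρ σ =
    (mpow σ (-1 / 2) * mpow ρ (1 / 2))ᴴ * (mpow σ (-1 / 2) * mpow ρ (1 / 2)) := by
  rw [conjTranspose_mul, (isHermitian_mpow _ _).eq, (isHermitian_mpow _ _).eq, relOp,
    ← mpow_neg_half_mul_self hσ]
  simp only [mul_assoc]

lemma posSemidef_relOp (hσ : σ.PosSemidef) : (relOp ρ σ).PosSemidef := by
  rw [relOp_eq hσ]
  exact posSemidef_conjTranspose_mul_self _

lemma suppProj_mul_mpow_half (hρ : ρ.PosSemidef) (h : ρ * suppProj σ = ρ) :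
    suppProj σ * mpow ρ (1 / 2) = mpow ρ (1 / 2) := by
  have h1 : mpow ρ (1 / 2) = ρ * mpow ρ (-1 / 2) := by
    conv_rhs => enter [1]; rw [← mpow_one hρ]
    rw [mpow_mul_mpow hρ one_ne_zero (by norm_num)]
    norm_num
  rw [h1, ← mul_assoc, suppProj_mul_of_mul_suppProj hρ.isHermitian h]

/-- When `ρ` lives on the support of `σ`, the kernel of `ρ ^ (1/2) σ⁻¹ ρ ^ (1/2)` is that of `ρ`.
The value of `Real.log` at `0` is thus irrelevant in the entropy. -/
lemma mul_suppProj_relOp (hρ : ρ.PosSemidef) (hσ : σ.PosSemidef) (h : ρ * suppProj σ = ρ) :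
    ρ * suppProj (relOp ρ σ) = ρ := by
  have hM := posSemidef_relOp (ρ := ρ) hσ
  have h1 : relOp ρ σ * (1 - suppProj (relOp ρ σ)) = 0 := by
    rw [mul_sub, mul_suppProj_self hM, mul_one, sub_self]
  generalize suppProj (relOp ρ σ) = Q at h1 ⊢
  rw [relOp_eq hσ, conjTranspose_mul_self_mul_eq_zero] at h1
  have h2 : mpow ρ (1 / 2) * (1 - Q) = 0 := by
    rw [← suppProj_mul_mpow_half hρ h, ← mpow_half_mul_neg_half hσ, mul_assoc, mul_assoc,
      ← mul_assoc (mpow σ (-1 / 2)), h1, mul_zero]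
  have h3 : ρ * (1 - Q) = 0 := by
    nth_rewrite 1 [← mpow_half_mul_self hρ]
    rw [mul_assoc, h2, mul_zero]
  rw [mul_sub, mul_one, sub_eq_zero] at h3
  exact h3.symm

lemma trace_parSum (hρ : ρ.PosSemidef) (t : ℝ) :
    (parSum ρ σ t).trace = (ρ * cfc (fun x : ℝ => (x + t)⁻¹) (relOp ρ σ)).trace := by
  rw [parSum, trace_mul_comm, ← mul_assoc, mpow_half_mul_self hρ]

lemma mul_parMin (hρ : ρ.PosSemidef) (hσ : σ.PosSemidef) (h : ρ * suppProj σ = ρ) (t : ℝ) :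
    σ * parMin ρ σ t = parSum ρ σ t := by
  rw [parMin, ← mul_assoc, mul_mpow_neg_one hσ, parSum, mul_assoc, ← mul_assoc (suppProj σ),
    suppProj_mul_mpow_half hρ h]

lemma add_mul_parMin (hρ : ρ.PosSemidef) (hσ : σ.PosSemidef) (h : ρ * suppProj σ = ρ)
    {t : ℝ} (ht : 0 < t) : (ρ + t • σ) * parMin ρ σ t = ρ := by
  have hM := posSemidef_relOp (ρ := ρ) hσ
  set K := cfc (fun x : ℝ => (x + t)⁻¹) (relOp ρ σ) with hK
  -- On the spectrum, `x (x + t)⁻¹ + t (x + t)⁻¹ = 1`.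
  have h1 : relOp ρ σ * K + t • K = 1 := by
    have e1 : relOp ρ σ = cfc (fun x : ℝ => x) (relOp ρ σ) :=
      (cfc_id' ℝ (relOp ρ σ) hM.isHermitian).symm
    have e2 : t • K = cfc (fun x : ℝ => t * (x + t)⁻¹) (relOp ρ σ) :=
      (cfc_const_mul t _ _ (continuousOn_spectrum _ _)).symm
    rw [e2]
    nth_rewrite 1 [e1]
    rw [hK, cfc_mul_cfc, ← cfc_add _ _ _ (continuousOn_spectrum _ _) (continuousOn_spectrum _ _),
      ← cfc_const_one ℝ (relOp ρ σ) hM.isHermitian]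
    refine cfc_congr fun x hx => ?_
    have : x + t ≠ 0 := by have := nonneg_of_mem_spectrum hM hx; positivity
    field_simp
  rw [add_mul, Matrix.smul_mul, mul_parMin hρ hσ h, parMin, parSum, ← hK]
  set s := mpow ρ (1 / 2) with hs
  have h2 : ρ * (mpow σ (-1) * (s * K * s)) = s * (relOp ρ σ * K) * s := by
    rw [relOp, ← hs, ← mpow_half_mul_self hρ, ← hs]
    simp only [mul_assoc]
  have h3 : t • (s * K * s) = s * (t • K) * s := by
    rw [Matrix.mul_smul, Matrix.smul_mul]
  rw [h2, h3, ← add_mul, ← mul_add, h1, mul_one, mpow_half_mul_self hρ]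

/-- Completing the square in the quadratic form that defines the parallel sum. -/
lemma quadratic_eq (hρ : ρ.PosSemidef) (hσ : σ.PosSemidef) (h : ρ * suppProj σ = ρ)
    {t : ℝ} (ht : 0 < t) (Z : Matrix n n ℂ) :
    t • (Zᴴ * σ * Z) + (1 - Z)ᴴ * ρ * (1 - Z) =
      (Z - parMin ρ σ t)ᴴ * (ρ + t • σ) * (Z - parMin ρ σ t) + t • parSum ρ σ t := by
  have h1 := add_mul_parMin hρ hσ h ht
  have h2 := mul_parMin hρ hσ h t
  set Y := parMin ρ σ t
  set R := parSum ρ σ t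
  have hN : (ρ + t • σ)ᴴ = ρ + t • σ := by
    rw [conjTranspose_add, conjTranspose_smul, hρ.isHermitian.eq, hσ.isHermitian.eq, star_trivial]
  have h3 : Yᴴ * (ρ + t • σ) = ρ := by
    have := congrArg conjTranspose h1
    rwa [conjTranspose_mul, hN, hρ.isHermitian.eq] at this
  have h4 : ρ * Y = ρ - t • R := by
    rw [eq_sub_iff_add_eq, ← h2, ← Matrix.smul_mul, ← add_mul, h1]
  have h5 : (Z - Y)ᴴ * (ρ + t • σ) * (Z - Y) =
      Zᴴ * (ρ + t • σ) * Z - Zᴴ * ρ - (ρ * Z - ρ * Y) := by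
    rw [conjTranspose_sub, sub_mul, h3, sub_mul, mul_sub, mul_sub, mul_assoc _ _ Y, h1]
  rw [h5, h4, conjTranspose_sub, conjTranspose_one]
  simp only [mul_add, add_mul, mul_sub, sub_mul, mul_one, one_mul, Matrix.mul_smul, Matrix.smul_mul]
  abel

end ParallelSum

/-! ### Equality in the data processing inequality -/

section DataProcessing

variable {n m : Type*} [Fintype n] [DecidableEq n] [Fintype m] [DecidableEq m]
  {i : Matrix m m ℂ →⋆ₐ[ℂ] Matrix n n ℂ} {T : Matrix n n ℂ → Matrix m m ℂ}
  {ρ σ : Matrix n n ℂ}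

/-- The defect in the joint concavity of the parallel sum under a partial trace. -/
lemma IsPartialTrace.trace_parSum_sub (hT : IsPartialTrace i T) (hρ : ρ.PosSemidef)
    (hσ : σ.PosSemidef) (h : ρ * suppProj σ = ρ) {t : ℝ} (ht : 0 < t) :
    t • ((parSum (T ρ) (T σ) t).trace - (parSum ρ σ t).trace) =
      ((i (parMin (T ρ) (T σ) t) - parMin ρ σ t)ᴴ * (ρ + t • σ) *
        (i (parMin (T ρ) (T σ) t) - parMin ρ σ t)).trace := by
  set Y := parMin (T ρ) (T σ) t with hY
  have h1 := congrArg Matrix.trace (quadratic_eq hρ hσ h ht (i Y))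
  have h2 := congrArg Matrix.trace
    (quadratic_eq (hT.posSemidef hρ) (hT.posSemidef hσ) (hT.mul_suppProj hσ h) ht Y)
  have h3 : (1 : Matrix n n ℂ) - i Y = i (1 - Y) := by rw [map_sub, map_one]
  rw [h3] at h1
  simp only [trace_add, trace_smul, hT.trace_conj] at h1 h2
  rw [← hY, sub_self, mul_zero, trace_zero, zero_add] at h2
  rw [smul_sub, ← h2, h1, add_sub_cancel_right]

/-- Saturation of data processing for the pair `ρ, σ`: both are recovered from their partial traces
by left multiplication with the same matrix. -/
def IsSaturated (i : Matrix m m ℂ →⋆ₐ[ℂ] Matrix n n ℂ) (T : Matrix n n ℂ → Matrix m m ℂ)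
    (ρ σ : Matrix n n ℂ) : Prop :=
  ∃ G : Matrix n n ℂ, ρ = G * i (T ρ) ∧ σ = G * i (T σ)

lemma IsSaturated.symm (h : IsSaturated i T ρ σ) : IsSaturated i T σ ρ :=
  let ⟨G, h1, h2⟩ := h
  ⟨G, h2, h1⟩

lemma IsPartialTrace.isSaturated_of_trace_parSum_eq (hT : IsPartialTrace i T) (hρ : ρ.PosSemidef)
    (hσ : σ.PosSemidef) (h : ρ * suppProj σ = ρ)
    (heq : (parSum ρ σ 1).trace.re = (parSum (T ρ) (T σ) 1).trace.re) : IsSaturated i T ρ σ := by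
  have h1 := hT.trace_parSum_sub hρ hσ h one_pos
  rw [one_smul, one_smul] at h1
  have hN : (ρ + σ).PosSemidef := hρ.add hσ
  have h2 := (hN.conjTranspose_mul_mul_same
    (i (parMin (T ρ) (T σ) 1) - parMin ρ σ 1)).trace_nonneg
  have h0 := Complex.ext (w := 0)
    (by rw [← h1, Complex.sub_re, heq, sub_self, Complex.zero_re]) (Complex.le_def.1 h2).2.symm
  replace h2 := mul_eq_zero_of_trace_conj_eq_zero hN h0
  have h3 := add_mul_parMin hρ hσ h one_pos
  have h4 := add_mul_parMin (hT.posSemidef hρ) (hT.posSemidef hσ) (hT.mul_suppProj hσ h) one_pos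
  rw [one_smul] at h3 h4
  rw [mul_sub, h3, sub_eq_zero] at h2
  rw [← hT.add] at h4
  have hN' := hT.posSemidef hN
  obtain ⟨N, hNdef⟩ : ∃ N, N = ρ + σ := ⟨_, rfl⟩
  rw [← hNdef] at hN hN' h2 h4
  -- With `N = ρ + σ` the common left factor is `G = N (T N)⁻¹`.
  have h5 : ρ = N * i (mpow (T N) (-1)) * i (T ρ) := by
    rw [mul_assoc, ← map_mul, ← h4, ← mul_assoc, mpow_neg_one_mul hN', map_mul, ← mul_assoc,
      hT.mul_map_suppProj hN, h2]
  have h6 : N = N * i (mpow (T N) (-1)) * i (T N) := by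
    rw [mul_assoc, ← map_mul, mpow_neg_one_mul hN', hT.mul_map_suppProj hN]
  refine ⟨_, h5, ?_⟩
  have h7 : i (T N) = i (T ρ) + i (T σ) := by rw [hNdef, hT.add, map_add]
  rw [h7, mul_add, ← h5] at h6
  exact add_left_cancel (hNdef.symm.trans h6)

lemma IsPartialTrace.trace_parSum_eq_of_isSaturated (hT : IsPartialTrace i T) (hρ : ρ.PosSemidef)
    (hσ : σ.PosSemidef) (h : ρ * suppProj σ = ρ) (hs : IsSaturated i T ρ σ) {t : ℝ} (ht : 0 < t) :
    (parSum ρ σ t).trace = (parSum (T ρ) (T σ) t).trace := by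
  obtain ⟨G, h1, h2⟩ := hs
  have h3 := hT.trace_parSum_sub hρ hσ h ht
  have h4 : (ρ + t • σ) * i (parMin (T ρ) (T σ) t) = ρ := by
    have e : ρ + t • σ = G * i (T ρ + t • T σ) := by
      conv_lhs => rw [h1, h2]
      rw [map_add, ← Complex.coe_smul, ← Complex.coe_smul, map_smul, mul_add, Matrix.mul_smul]
    rw [e, mul_assoc, ← map_mul, add_mul_parMin (hT.posSemidef hρ) (hT.posSemidef hσ)
      (hT.mul_suppProj hσ h) ht, ← h1]
  rw [mul_assoc, mul_sub, h4, add_mul_parMin hρ hσ h ht, sub_self, mul_zero, trace_zero,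
    smul_eq_zero] at h3
  exact (sub_eq_zero.1 (h3.resolve_left ht.ne')).symm

lemma IsPartialTrace.re_trace_parSum_le (hT : IsPartialTrace i T) (hρ : ρ.PosSemidef)
    (hσ : σ.PosSemidef) (h : ρ * suppProj σ = ρ) {t : ℝ} (ht : 0 < t) :
    (parSum ρ σ t).trace.re ≤ (parSum (T ρ) (T σ) t).trace.re := by
  have h1 := hT.trace_parSum_sub hρ hσ h ht
  have h2 : 0 ≤ ((i (parMin (T ρ) (T σ) t) - parMin ρ σ t)ᴴ * (ρ + t • σ) *
        (i (parMin (T ρ) (T σ) t) - parMin ρ σ t)).trace :=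
    ((hρ.add (hσ.smul ht.le)).conjTranspose_mul_mul_same _).trace_nonneg
  rw [← h1] at h2
  have h3 := (Complex.le_def.1 h2).1
  rw [Complex.zero_re, Complex.smul_re, Complex.sub_re, smul_eq_mul] at h3
  exact sub_nonneg.1 (nonneg_of_mul_nonneg_right h3 ht)

lemma bsEntropy_of_mul_suppProj (hσ : σ.PosSemidef) (h : ρ * suppProj σ = ρ) :
    bsEntropy ρ σ = (((ρ * mlog (relOp ρ σ)).trace.re : ℝ) : EReal) :=
  if_pos ((ker_le_ker_iff hσ).2 h)

lemma mul_suppProj_of_bsEntropy_ne_top (hσ : σ.PosSemidef) (h : bsEntropy ρ σ ≠ ⊤) :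
    ρ * suppProj σ = ρ := by
  by_contra hc
  exact h (if_neg fun hk => hc ((ker_le_ker_iff hσ).1 hk))

/-- Equality in the data processing inequality of the Belavkin-Staszewski entropy under a partial
trace. -/
theorem IsPartialTrace.bsEntropy_sub_eq_zero_iff (hT : IsPartialTrace i T) (hρ : ρ.PosSemidef)
    (hσ : σ.PosSemidef) (h : ρ * suppProj σ = ρ) :
    bsEntropy ρ σ - bsEntropy (T ρ) (T σ) = 0 ↔ IsSaturated i T ρ σ := by
  have hρ' := hT.posSemidef hρ
  have hσ' := hT.posSemidef hσ
  have h' := hT.mul_suppProj hσ h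
  rw [bsEntropy_of_mul_suppProj hσ h, bsEntropy_of_mul_suppProj hσ' h', ← EReal.coe_sub,
    EReal.coe_eq_zero, sub_eq_zero]
  obtain ⟨w, p, hp, hw, hwp⟩ := exists_weights (posSemidef_relOp (ρ := ρ) hσ)
    (mul_suppProj_relOp hρ hσ h)
  obtain ⟨v, q, hq, hv, hvq⟩ := exists_weights (posSemidef_relOp (ρ := T ρ) hσ')
    (mul_suppProj_relOp hρ' hσ' h')
  have hK : ∀ t : ℝ, (parSum ρ σ t).trace.re = ∑ j, w j * (p j + t)⁻¹ := fun t => by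
    rw [trace_parSum hρ, hwp]
  have hK' : ∀ t : ℝ, (parSum (T ρ) (T σ) t).trace.re = ∑ j, v j * (q j + t)⁻¹ := fun t => by
    rw [trace_parSum hρ', hvq]
  -- Both total masses are the trace of `ρ`.
  have hsum : ∑ j, w j = ∑ j, v j := by
    have e1 := hwp fun _ => 1
    have e2 := hvq fun _ => 1
    rw [show cfc (fun _ : ℝ => (1 : ℝ)) (relOp ρ σ) = 1 from
      cfc_const_one ℝ _ (posSemidef_relOp hσ).isHermitian] at e1
    rw [show cfc (fun _ : ℝ => (1 : ℝ)) (relOp (T ρ) (T σ)) = 1 from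
      cfc_const_one ℝ _ (posSemidef_relOp hσ').isHermitian] at e2
    simp only [mul_one, hT.trace] at e1 e2
    exact e1.symm.trans e2
  rw [mlog, mlog, hwp, hvq, sum_mul_log_eq_iff hp hw hq hv hsum fun t ht => by
    rw [← hK, ← hK']; exact hT.re_trace_parSum_le hρ hσ h ht]
  constructor
  · intro heq
    refine hT.isSaturated_of_trace_parSum_eq hρ hσ h ?_
    rw [hK, hK', heq 1 one_pos]
  · intro hs t ht
    rw [← hK, ← hK', hT.trace_parSum_eq_of_isSaturated hρ hσ h hs ht]

end DataProcessing

/-! ### Bipartite amplifications and partial traces -/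

section Tensor

variable {m k : Type*} [Fintype m] [DecidableEq m] [Fintype k] [DecidableEq k]

/-- The amplification `X ↦ X ⊗ 1`. -/
def ampLeft (m k : Type*) [Fintype m] [DecidableEq m] [Fintype k] [DecidableEq k] :
    Matrix m m ℂ →⋆ₐ[ℂ] Matrix (m × k) (m × k) ℂ where
  toFun X := X ⊗ₖ (1 : Matrix k k ℂ)
  map_one' := one_kronecker_one
  map_mul' X Y := by rw [← mul_kronecker_mul, mul_one]
  map_zero' := zero_kronecker _
  map_add' X Y := add_kronecker X Y _
  commutes' r := by
    rw [Algebra.algebraMap_eq_smul_one, Algebra.algebraMap_eq_smul_one, smul_kronecker,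
      one_kronecker_one]
  map_star' X := by
    rw [star_eq_conjTranspose, star_eq_conjTranspose, conjTranspose_kronecker, conjTranspose_one]

/-- The amplification `X ↦ 1 ⊗ X`. -/
def ampRight (m k : Type*) [Fintype m] [DecidableEq m] [Fintype k] [DecidableEq k] :
    Matrix k k ℂ →⋆ₐ[ℂ] Matrix (m × k) (m × k) ℂ where
  toFun X := (1 : Matrix m m ℂ) ⊗ₖ X
  map_one' := one_kronecker_one
  map_mul' X Y := by rw [← mul_kronecker_mul, mul_one]
  map_zero' := kronecker_zero _
  map_add' X Y := kronecker_add _ X Y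
  commutes' r := by
    rw [Algebra.algebraMap_eq_smul_one, Algebra.algebraMap_eq_smul_one, kronecker_smul,
      one_kronecker_one]
  map_star' X := by
    rw [star_eq_conjTranspose, star_eq_conjTranspose, conjTranspose_kronecker, conjTranspose_one]

lemma ampLeft_apply (X : Matrix m m ℂ) : ampLeft m k X = X ⊗ₖ (1 : Matrix k k ℂ) := rfl

lemma ampLeft_apply_apply (X : Matrix m m ℂ) (i j : m × k) :
    ampLeft m k X i j = if i.2 = j.2 then X i.1 j.1 else 0 := by
  rw [ampLeft_apply, kronecker_apply, one_apply, mul_ite, mul_one, mul_zero]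

lemma ampRight_apply (X : Matrix k k ℂ) : ampRight m k X = (1 : Matrix m m ℂ) ⊗ₖ X := rfl

lemma ampLeft_mul_ampRight (X : Matrix m m ℂ) (Y : Matrix k k ℂ) :
    ampLeft m k X * ampRight m k Y = X ⊗ₖ Y := by
  rw [ampLeft_apply, ampRight_apply, ← mul_kronecker_mul, mul_one, one_mul]

/-- The partial trace over the second factor. -/
def traceRight (X : Matrix (m × k) (m × k) ℂ) : Matrix m m ℂ :=
  Matrix.of fun i j => ∑ z, X (i, z) (j, z)

/-- The partial trace over the first factor. -/
def traceLeft (X : Matrix (m × k) (m × k) ℂ) : Matrix k k ℂ :=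
  Matrix.of fun i j => ∑ x, X (x, i) (x, j)

lemma isPartialTrace_traceRight : IsPartialTrace (ampLeft m k) traceRight where
  trace_mul X Z := by
    simp only [trace, diag_apply, mul_apply, ampLeft_apply, traceRight, of_apply,
      Fintype.sum_prod_type, kronecker_apply, one_apply, mul_ite, mul_one, mul_zero,
      Finset.sum_ite_eq', Finset.mem_univ, if_true, Finset.sum_mul]
    exact Finset.sum_congr rfl fun i _ => Finset.sum_comm

lemma isPartialTrace_traceLeft : IsPartialTrace (ampRight m k) traceLeft where
  trace_mul X Z := by
    simp only [trace, diag_apply, mul_apply, ampRight_apply, traceLeft, of_apply,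
      Fintype.sum_prod_type, kronecker_apply, one_apply, ite_mul, one_mul, zero_mul, mul_ite,
      mul_zero, Finset.sum_ite_irrel, Finset.sum_const_zero,
      Finset.sum_ite_eq', Finset.mem_univ, if_true, Finset.sum_mul]
    rw [Finset.sum_comm]
    exact Finset.sum_congr rfl fun i _ => Finset.sum_comm

end Tensor

/-! ### Marginals of a tripartite operator -/

section Marginals

variable {a b c : Type*} [Fintype a]

lemma margBC_kronecker (X : Matrix (a × b) (a × b) ℂ) (Y : Matrix c c ℂ) :
    margBC (X ⊗ₖ Y) = traceLeft X ⊗ₖ Y := by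
  ext i j
  simp [margBC, traceLeft, Finset.sum_mul]

variable [Fintype c]

lemma traceLeft_margAB (X : Matrix ((a × b) × c) ((a × b) × c) ℂ) :
    traceLeft (margAB X) = margB X := rfl

lemma traceRight_margBC (X : Matrix ((a × b) × c) ((a × b) × c) ℂ) :
    traceRight (margBC X) = margB X := by
  ext i j
  simp only [traceRight, margBC, margB, of_apply]
  exact Finset.sum_comm

end Marginals

/-! ### Tripartite amplifications and partial traces -/

section Tripartite

variable {a b c : Type*} [Fintype a] [Fintype b] [Fintype c]
  [DecidableEq a] [DecidableEq b] [DecidableEq c]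

/-- The amplification of operators on `BC` to operators on `ABC`. -/
def ampBC (a b c : Type*) [Fintype a] [Fintype b] [Fintype c]
    [DecidableEq a] [DecidableEq b] [DecidableEq c] :
    Matrix (b × c) (b × c) ℂ →⋆ₐ[ℂ] Matrix ((a × b) × c) ((a × b) × c) ℂ where
  toFun X := ((1 : Matrix a a ℂ) ⊗ₖ X).submatrix (Equiv.prodAssoc a b c) (Equiv.prodAssoc a b c)
  map_one' := by rw [one_kronecker_one, submatrix_one_equiv]
  map_mul' X Y := by rw [submatrix_mul_equiv, ← mul_kronecker_mul, mul_one]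
  map_zero' := by rw [kronecker_zero, submatrix_zero]; rfl
  map_add' X Y := by rw [kronecker_add, submatrix_add]; rfl
  commutes' r := by
    rw [Algebra.algebraMap_eq_smul_one, Algebra.algebraMap_eq_smul_one, kronecker_smul,
      one_kronecker_one, submatrix_smul, Pi.smul_apply, Pi.smul_apply, submatrix_one_equiv]
  map_star' X := by
    rw [star_eq_conjTranspose, star_eq_conjTranspose, conjTranspose_submatrix,
      conjTranspose_kronecker, conjTranspose_one]

lemma ampBC_apply (X : Matrix (b × c) (b × c) ℂ) (i j : (a × b) × c) :
    ampBC a b c X i j = if i.1.1 = j.1.1 then X (i.1.2, i.2) (j.1.2, j.2) else 0 := by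
  change (1 : Matrix a a ℂ) i.1.1 j.1.1 * X (i.1.2, i.2) (j.1.2, j.2) = _
  rw [one_apply, ite_mul, one_mul, zero_mul]

lemma ampBC_kronecker (X : Matrix b b ℂ) (Y : Matrix c c ℂ) :
    ampBC a b c (X ⊗ₖ Y) = ((1 : Matrix a a ℂ) ⊗ₖ X) ⊗ₖ Y := by
  ext i j
  rw [ampBC_apply, kronecker_apply, kronecker_apply, kronecker_apply, one_apply]
  split_ifs <;> simp

lemma isPartialTrace_margBC : IsPartialTrace (ampBC a b c) margBC where
  trace_mul X Z := by
    simp only [trace, diag_apply, mul_apply, ampBC_apply, margBC, of_apply,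
      Fintype.sum_prod_type, mul_ite, mul_zero, Finset.sum_ite_irrel, Finset.sum_const_zero,
      Finset.sum_ite_eq', Finset.mem_univ, if_true, Finset.sum_mul]
    rw [Finset.sum_comm]
    refine Finset.sum_congr rfl fun y _ => ?_
    rw [Finset.sum_comm]
    refine Finset.sum_congr rfl fun z _ => ?_
    rw [Finset.sum_comm]
    refine Finset.sum_congr rfl fun y' _ => ?_
    rw [Finset.sum_comm]

lemma isPartialTrace_margAB : IsPartialTrace (ampLeft (a × b) c) margAB :=
  isPartialTrace_traceRight

lemma isPartialTrace_margC : IsPartialTrace (ampRight (a × b) c) margC := by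
  have h : (margC : Matrix ((a × b) × c) ((a × b) × c) ℂ → Matrix c c ℂ) = traceLeft := by
    ext X i j
    simp [margC, traceLeft, Fintype.sum_prod_type]
  exact h ▸ isPartialTrace_traceLeft

/-- `Φ ⊗ id` for a map of the form `X ↦ V (1 ⊗ X) W`. -/
lemma tensorId_eq {k : Type*} [Fintype k] [DecidableEq k]
    {Φ : Matrix b b ℂ →ₗ[ℂ] Matrix (a × b) (a × b) ℂ} {V W : Matrix (a × b) (a × b) ℂ}
    (h : ∀ X, Φ X = V * ampB X * W) (X : Matrix (b × k) (b × k) ℂ) :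
    tensorId Φ X = ampLeft (a × b) k V * ampBC a b k X * ampLeft (a × b) k W := by
  ext i j
  simp only [tensorId, of_apply, h, ampB, ampLeft_apply_apply, mul_apply, kronecker_apply,
    one_apply, ampBC_apply, mul_ite, ite_mul, one_mul, mul_zero, zero_mul,
    Finset.sum_ite_irrel, Finset.sum_const_zero,
    Finset.sum_ite_eq, Finset.sum_ite_eq', Finset.mem_univ, if_true, Fintype.sum_prod_type]

end Tripartite

/-! ### Functional calculus under star homomorphisms -/

section StarHom

variable {n m : Type*} [Fintype n] [DecidableEq n] [Fintype m] [DecidableEq m]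

lemma posSemidef_map (i : Matrix m m ℂ →⋆ₐ[ℂ] Matrix n n ℂ) {X : Matrix m m ℂ}
    (hX : X.PosSemidef) : (i X).PosSemidef := by
  rw [← mpow_half_mul_self hX, map_mul]
  nth_rewrite 1 [← (isHermitian_mpow X (1 / 2)).eq]
  rw [← IsPartialTrace.map_conjTranspose]
  exact posSemidef_conjTranspose_mul_self _

lemma map_mpow (i : Matrix m m ℂ →⋆ₐ[ℂ] Matrix n n ℂ) {X : Matrix m m ℂ}
    (hX : X.PosSemidef) (r : ℝ) : i (mpow X r) = mpow (i X) r := by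
  have hi : Continuous i := i.toAlgHom.toLinearMap.continuous_of_finiteDimensional
  exact StarAlgHomClass.map_cfc i _ X (continuousOn_spectrum _ _) hi hX.isHermitian
    (posSemidef_map i hX).isHermitian

end StarHom

/-! ### Commutation from a fixed point -/

section Commutation

variable {n m : Type*} [Fintype n] [DecidableEq n] [Fintype m] [DecidableEq m]
  {i : Matrix m m ℂ →⋆ₐ[ℂ] Matrix n n ℂ} {T : Matrix n n ℂ → Matrix m m ℂ}

/-- A Hermitian fixed point `y` of the map `z ↦ T (S (z ⊗ 1) S)`, which is unital and
trace-preserving on the relevant support, commutes with `S`, because the Hilbert-Schmidt norm of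
the commutator is `2 tr (S² y²) - 2 tr (S y S y) = 0`. -/
lemma IsPartialTrace.commute_of_fixed (hT : IsPartialTrace i T) {S : Matrix n n ℂ}
    {y : Matrix m m ℂ} (hS : S.IsHermitian) (hy : y.IsHermitian)
    (h1 : T (S * S) * y = y) (h2 : T (S * i y * S) = y) : S * i y = i y * S := by
  have hY : (i y)ᴴ = i y := by rw [map_conjTranspose, hy.eq]
  have e1 : (S * S * (i y * i y)).trace = (y * y).trace := by
    rw [← map_mul, hT.trace_mul, ← mul_assoc, h1]
  have e2 : (S * i y * S * i y).trace = (y * y).trace := by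
    rw [hT.trace_mul, h2]
  set Y := i y
  have h3 : ((S * Y - Y * S)ᴴ * (S * Y - Y * S)).trace = 0 := by
    rw [conjTranspose_sub, conjTranspose_mul, conjTranspose_mul, hS.eq, hY]
    have e3 : (Y * S - S * Y) * (S * Y - Y * S) =
        Y * (S * S * Y) - Y * (S * Y * S) - S * Y * S * Y + (S * Y * Y) * S := by
      simp only [sub_mul, mul_sub, mul_assoc]
      abel
    rw [e3, trace_add, trace_sub, trace_sub, trace_mul_comm Y, trace_mul_comm Y,
      trace_mul_comm _ S, e2]
    have e4 : (S * S * Y * Y).trace = (y * y).trace := by rw [← e1, mul_assoc _ Y Y]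
    have e5 : (S * (S * Y * Y)).trace = (y * y).trace := by
      rw [← e1]; simp only [mul_assoc]
    rw [e4, e5]
    ring
  rw [trace_conjTranspose_mul_self_eq_zero_iff, sub_eq_zero] at h3
  exact h3

end Commutation

/-! ### The recovery map -/

section RecoveryMap

lemma isHermitian_ampB {a b : Type*} [DecidableEq a] {X : Matrix b b ℂ} (hX : X.IsHermitian) :
    (ampB X : Matrix (a × b) (a × b) ℂ).IsHermitian := by
  unfold IsHermitian ampB
  rw [conjTranspose_kronecker, conjTranspose_one, hX.eq]

variable {a b c : Type*} [Fintype a] [Fintype b] [Fintype c] [DecidableEq a] [DecidableEq b]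
  {ρ : Matrix ((a × b) × c) ((a × b) × c) ℂ}

/-- The operator `V` of the form `Φ(X) = V X Vᴴ` of the recovery map. -/
noncomputable def recoveryOp (ρ : Matrix ((a × b) × c) ((a × b) × c) ℂ) :
    Matrix (a × b) (a × b) ℂ :=
  ampB (mpow (margB ρ) (1 / 2)) * midAB ρ * ampB (mpow (margB ρ) (-1 / 2))

lemma recoveryMap_apply (X : Matrix b b ℂ) :
    recoveryMap ρ X = recoveryOp ρ * ampB X * (recoveryOp ρ)ᴴ := by
  have h : (recoveryOp ρ)ᴴ =
      ampB (mpow (margB ρ) (-1 / 2)) * midAB ρ * ampB (mpow (margB ρ) (1 / 2)) := by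
    rw [recoveryOp, conjTranspose_mul, conjTranspose_mul,
      (isHermitian_ampB (isHermitian_mpow _ _)).eq, (isHermitian_ampB (isHermitian_mpow _ _)).eq,
      show (midAB ρ)ᴴ = midAB ρ from (isHermitian_mpow _ _).eq, mul_assoc]
  rw [h, recoveryOp]
  simp only [recoveryMap, LinearMap.coe_mk, AddHom.coe_mk, mul_assoc]

lemma isCompletelyPositive_recoveryMap : IsCompletelyPositive (recoveryMap ρ) := by
  intro k X hX
  rw [tensorId_eq recoveryMap_apply, ← IsPartialTrace.map_conjTranspose]
  exact (posSemidef_map (ampBC a b (Fin k)) hX).mul_mul_conjTranspose_same _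

end RecoveryMap

/-! ### The maximally mixed state -/

section MaximallyMixed

/-- The trace of a state is `1`, so that no tensor factor is trivial. -/
lemma nonempty_of_isState {n c : Type*} [Fintype n] [Fintype c]
    {ρ : Matrix (n × c) (n × c) ℂ} (hρ : IsState ρ) : Nonempty c := by
  by_contra h
  rw [not_nonempty_iff] at h
  have := hρ.2
  simp [trace] at this

variable {c : Type*} [Fintype c] [DecidableEq c]

lemma posSemidef_maxMixed : (maxMixed c).PosSemidef :=
  PosSemidef.one.smul (by positivity)

lemma suppProj_maxMixed [Nonempty c] : suppProj (maxMixed c) = 1 := by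
  have h1 := mul_suppProj_self (posSemidef_maxMixed (c := c))
  have h2 : (Fintype.card c : ℂ) ≠ 0 := Nat.cast_ne_zero.2 Fintype.card_ne_zero
  have h3 : (Fintype.card c : ℂ) • maxMixed c = 1 := by
    rw [maxMixed, smul_smul, mul_inv_cancel₀ h2, one_smul]
  calc suppProj (maxMixed c) = (Fintype.card c : ℂ) • maxMixed c * suppProj (maxMixed c) := by
        rw [h3, one_mul]
    _ = 1 := by rw [Matrix.smul_mul, h1, h3]

end MaximallyMixed

/-! ### Markov chains -/

section MarkovChain

variable {a b c : Type*} [Fintype a] [Fintype b] [Fintype c]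
  [DecidableEq a] [DecidableEq b] [DecidableEq c]
  {ρ : Matrix ((a × b) × c) ((a × b) × c) ℂ}

/-- The identity `ρ_ABC = ρ_AB ρ_B⁻¹ ρ_BC`, all factors being amplified to `ABC` and the inverse
being taken on the support of `ρ_B`. -/
def IsProductChain (ρ : Matrix ((a × b) × c) ((a × b) × c) ℂ) : Prop :=
  ρ = ampLeft (a × b) c (margAB ρ) * ampBC a b c (mpow (margB ρ) (-1) ⊗ₖ 1) *
    ampBC a b c (margBC ρ)

lemma posSemidef_margB (hρ : ρ.PosSemidef) : (margB ρ).PosSemidef := by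
  rw [← traceLeft_margAB]
  exact isPartialTrace_traceLeft.posSemidef (isPartialTrace_margAB.posSemidef hρ)

lemma ampBC_kronecker_one (X : Matrix b b ℂ) :
    ampBC a b c (X ⊗ₖ 1) = ampLeft (a × b) c (ampB X) :=
  ampBC_kronecker X 1

lemma ampBC_one_kronecker (X : Matrix c c ℂ) :
    ampBC a b c (1 ⊗ₖ X) = ampRight (a × b) c X := by
  rw [ampBC_kronecker, one_kronecker_one, ampRight_apply]

lemma margAB_mul_suppProj (hρ : ρ.PosSemidef) :
    margAB ρ * ampB (suppProj (margB ρ)) = margAB ρ :=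
  isPartialTrace_traceLeft.mul_map_suppProj (isPartialTrace_margAB.posSemidef hρ)

lemma suppProj_mul_margBC (hρ : ρ.PosSemidef) :
    (suppProj (margB ρ) ⊗ₖ 1) * margBC ρ = margBC ρ := by
  rw [← traceRight_margBC]
  exact isPartialTrace_traceRight.map_suppProj_mul (isPartialTrace_margBC.posSemidef hρ)

lemma mul_suppProj_margAB_kronecker (hρ : ρ.PosSemidef) {ω : Matrix c c ℂ} (hω : ω.PosSemidef)
    (h : ρ * ampRight (a × b) c (suppProj ω) = ρ) :
    ρ * suppProj (margAB ρ ⊗ₖ ω) = ρ := by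
  have hA := isPartialTrace_margAB.posSemidef hρ
  refine mul_suppProj_of_eq_mul (hA.kronecker hω)
    (W := ρ * (mpow (margAB ρ) (-1) ⊗ₖ mpow ω (-1))) ?_
  rw [mul_assoc, ← mul_kronecker_mul, mpow_neg_one_mul hA, mpow_neg_one_mul hω,
    ← ampLeft_mul_ampRight, ← mul_assoc, isPartialTrace_margAB.mul_map_suppProj hρ, h]

/-- For the pair `ρ_ABC, ρ_AB ⊗ ω`, saturation under the partial trace over `A` does not depend on
the operator `ω`, as long as `ρ_ABC` lives on its support. -/
lemma isSaturated_iff_isProductChain (hρ : ρ.PosSemidef) {ω : Matrix c c ℂ} (hω : ω.PosSemidef)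
    (h : ρ * ampRight (a × b) c (suppProj ω) = ρ) :
    IsSaturated (ampBC a b c) margBC ρ (margAB ρ ⊗ₖ ω) ↔ IsProductChain ρ := by
  have hB := posSemidef_margB hρ
  have hTω : margBC (margAB ρ ⊗ₖ ω) = margB ρ ⊗ₖ ω := margBC_kronecker _ _
  have hωBC : (1 ⊗ₖ suppProj ω) * margBC ρ = margBC ρ := by
    rw [← ampBC_one_kronecker] at h
    have h' := congrArg margBC h
    rw [isPartialTrace_margBC.mul_right] at h'
    have h'' := congrArg conjTranspose h'
    rwa [conjTranspose_mul, conjTranspose_kronecker, conjTranspose_one,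
      (isHermitian_suppProj ω).eq, (isPartialTrace_margBC.posSemidef hρ).isHermitian.eq] at h''
  rw [IsSaturated, hTω, IsProductChain]
  constructor
  · rintro ⟨G, h1, h2⟩
    have h3 := congrArg (· * ampBC a b c (mpow (margB ρ) (-1) ⊗ₖ mpow ω (-1)) *
      ampBC a b c (margBC ρ)) h2
    simp only at h3
    have e2 : (margB ρ ⊗ₖ ω) * (mpow (margB ρ) (-1) ⊗ₖ mpow ω (-1)) * margBC ρ = margBC ρ := by
      rw [← mul_kronecker_mul, mul_mpow_neg_one hB, mul_mpow_neg_one hω,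
        ← ampLeft_mul_ampRight, mul_assoc, ampRight_apply, hωBC, ampLeft_apply,
        suppProj_mul_margBC hρ]
    rw [mul_assoc G, mul_assoc G, ← map_mul, ← map_mul, e2, ← h1, ampBC_kronecker,
      ← mul_kronecker_mul, mul_mpow_neg_one hω, ← ampLeft_mul_ampRight, map_mul,
      ← ampBC_one_kronecker, mul_assoc _ (ampBC a b c (1 ⊗ₖ suppProj ω)),
      ← map_mul (ampBC a b c), hωBC] at h3
    rw [ampBC_kronecker_one, ampB]
    exact h3.symm
  · intro h1
    refine ⟨_, h1, ?_⟩
    rw [mul_assoc, ← map_mul, ← mul_kronecker_mul, mpow_neg_one_mul hB, one_mul, ampBC_kronecker,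
      ampLeft_apply, ← mul_kronecker_mul, one_mul]
    congr 1
    exact (margAB_mul_suppProj hρ).symm

/-- The product form and the recovery identity are equivalent: each of them forces the square root
in the recovery map to commute with `ρ_B ^ (-1/2) ρ_BC ρ_B ^ (-1/2)`. -/
lemma isProductChain_iff (hρ : ρ.PosSemidef) :
    IsProductChain ρ ↔ tensorId (recoveryMap ρ) (margBC ρ) = ρ := by
  have hB := posSemidef_margB hρ
  have hAB := isPartialTrace_margAB.posSemidef hρ
  have hBC := isPartialTrace_margBC.posSemidef hρ
  have hT := isPartialTrace_margBC (a := a) (b := b) (c := c)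
  rw [tensorId_eq recoveryMap_apply, ← IsPartialTrace.map_conjTranspose, IsProductChain]
  set jL := ampLeft (a × b) c with hjL
  set jBC := ampBC a b c with hjBC
  set jB : Matrix b b ℂ → Matrix ((a × b) × c) ((a × b) × c) ℂ := fun Z => jBC (Z ⊗ₖ 1) with hjB
  have hjB_mul : ∀ Z W, jB Z * jB W = jB (Z * W) := fun Z W => by
    simp only [hjB]
    rw [← map_mul, ← mul_kronecker_mul, one_mul]
  have hjB_L : ∀ Z, jL (ampB Z) = jB Z := fun Z => (ampBC_kronecker_one Z).symm
  have hjB_herm : ∀ {Z : Matrix b b ℂ}, Z.IsHermitian → (jB Z)ᴴ = jB Z := fun {Z} hZ => by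
    simp only [hjB]
    rw [IsPartialTrace.map_conjTranspose, conjTranspose_kronecker, conjTranspose_one, hZ.eq]
  obtain ⟨s, hs⟩ : ∃ s, s = jB (mpow (margB ρ) (1 / 2)) := ⟨_, rfl⟩
  obtain ⟨r, hr⟩ : ∃ r, r = jB (mpow (margB ρ) (-1 / 2)) := ⟨_, rfl⟩
  obtain ⟨P, hP⟩ : ∃ P, P = jB (suppProj (margB ρ)) := ⟨_, rfl⟩
  obtain ⟨S, hS⟩ : ∃ S, S = jL (midAB ρ) := ⟨_, rfl⟩
  obtain ⟨A, hA⟩ : ∃ A, A = jL (margAB ρ) := ⟨_, rfl⟩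
  obtain ⟨R, hR⟩ : ∃ R, R = jBC (margBC ρ) := ⟨_, rfl⟩
  have hsr : s * r = P := by rw [hs, hr, hjB_mul, mpow_half_mul_neg_half hB, hP]
  have hrs : r * s = P := by rw [hs, hr, hjB_mul, mpow_neg_half_mul_half hB, hP]
  have hrr : r * r = jB (mpow (margB ρ) (-1)) := by rw [hr, hjB_mul, mpow_neg_half_mul_self hB]
  have hrP : r * P = r := by rw [hr, hP, hjB_mul, mpow_mul_suppProj _ (by norm_num)]
  have hPr : P * r = r := by rw [hr, hP, hjB_mul, suppProj_mul_mpow _ (by norm_num)]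
  have hr' : rᴴ = r := by rw [hr, hjB_herm (isHermitian_mpow _ _)]
  have hs' : sᴴ = s := by rw [hs, hjB_herm (isHermitian_mpow _ _)]
  have hP' : Pᴴ = P := by rw [hP, hjB_herm (isHermitian_suppProj _)]
  have hA' : Aᴴ = A := by rw [hA, IsPartialTrace.map_conjTranspose, hAB.isHermitian.eq]
  have hR' : Rᴴ = R := by rw [hR, IsPartialTrace.map_conjTranspose, hBC.isHermitian.eq]
  have hAP : A * P = A := by rw [hA, hP, ← hjB_L, ← map_mul, margAB_mul_suppProj hρ]
  have hPA : P * A = A := by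
    simpa only [conjTranspose_mul, hA', hP'] using congrArg conjTranspose hAP
  have hPR : P * R = R := by rw [hR, hP, hjB, ← map_mul, suppProj_mul_margBC hρ]
  have hRP : R * P = R := by
    simpa only [conjTranspose_mul, hR', hP'] using congrArg conjTranspose hPR
  have hmid : (ampB (mpow (margB ρ) (-1 / 2)) * margAB ρ *
      ampB (mpow (margB ρ) (-1 / 2))).PosSemidef := by
    have := hAB.mul_mul_conjTranspose_same (ampB (a := a) (mpow (margB ρ) (-1 / 2)))
    rwa [(isHermitian_ampB (isHermitian_mpow _ _)).eq] at this
  have hX : jL (ampB (mpow (margB ρ) (-1 / 2)) * margAB ρ * ampB (mpow (margB ρ) (-1 / 2))) =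
      r * A * r := by
    rw [map_mul, map_mul, hjB_L, hr, hA]
  have hSX : S = mpow (r * A * r) (1 / 2) := by rw [hS, midAB, map_mpow _ hmid, hX]
  have hXpos : (r * A * r).PosSemidef := hX ▸ posSemidef_map jL hmid
  have hSS : S * S = r * A * r := by rw [hSX, mpow_half_mul_self hXpos]
  have hS' : Sᴴ = S := by rw [hSX, (isHermitian_mpow _ _).eq]
  have hSP : S * P = S := by
    have h1 : Sᴴ * S * (1 - P) = 0 := by
      rw [hS', hSS, mul_sub, mul_one, mul_assoc _ r P, hrP, sub_self]
    rw [conjTranspose_mul_self_mul_eq_zero, mul_sub, mul_one, sub_eq_zero] at h1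
    exact h1.symm
  have hPS : P * S = S := by
    simpa only [conjTranspose_mul, hS', hP'] using congrArg conjTranspose hSP
  have hV : jL (recoveryOp ρ) = s * S * r := by
    rw [recoveryOp, map_mul, map_mul, hjB_L, hjB_L, hs, hS, hr]
  -- `y` is `ρ_B ^ (-1/2) ρ_BC ρ_B ^ (-1/2)`, and `Y` is its amplification.
  obtain ⟨y, hy⟩ : ∃ y, y = (mpow (margB ρ) (-1 / 2) ⊗ₖ 1) * margBC ρ *
    (mpow (margB ρ) (-1 / 2) ⊗ₖ 1) := ⟨_, rfl⟩
  have hY : jBC y = r * R * r := by rw [hy, map_mul, map_mul, hr, hR]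
  have hy' : y.IsHermitian := by
    unfold IsHermitian
    rw [hy, conjTranspose_mul, conjTranspose_mul, conjTranspose_kronecker, conjTranspose_one,
      (isHermitian_mpow _ _).eq, hBC.isHermitian.eq, mul_assoc]
  have hYherm : (r * R * r)ᴴ = r * R * r := by
    rw [← hY, IsPartialTrace.map_conjTranspose, hy'.eq]
  -- If `S` commutes with `Y`, the recovered operator is the product chain.
  have key : S * (r * R * r) = (r * R * r) * S →
      s * S * r * R * (r * S * s) = A * jB (mpow (margB ρ) (-1)) * R := by
    intro hc
    calc s * S * r * R * (r * S * s) = s * (S * ((r * R * r) * S)) * s := by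
          simp only [mul_assoc]
      _ = s * (r * A * r * (r * R * r)) * s := by
          rw [← hc, ← mul_assoc S S, hSS]
      _ = (s * r * A) * (r * r) * (R * (r * s)) := by simp only [mul_assoc]
      _ = A * jB (mpow (margB ρ) (-1)) * R := by rw [hsr, hrs, hPA, hRP, hrr]
  rw [hV, ← hA, ← hR, show (s * S * r)ᴴ = r * S * s by
    rw [conjTranspose_mul, conjTranspose_mul, hr', hs', hS', mul_assoc]]
  change ρ = A * jB (mpow (margB ρ) (-1)) * R ↔ _
  constructor
  · intro h
    rw [key, ← h]
    have h1 : r * ρ * r = r * A * r * (r * R * r) := by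
      rw [h, ← hrr]
      simp only [mul_assoc]
    have h2 := congrArg conjTranspose h1
    rw [conjTranspose_mul, conjTranspose_mul, hr', hρ.isHermitian.eq, ← mul_assoc, h1,
      conjTranspose_mul, hYherm, hXpos.isHermitian.eq] at h2
    have hcomm : Commute (r * A * r) (r * R * r) := h2
    rw [hSX]
    exact commute_mpow hcomm
  · intro h
    rw [← key, h]
    have h1 : r * ρ * r = S * (r * R * r) * S := by
      calc r * ρ * r = (r * s) * S * (r * R * r) * S * (s * r) := by
            rw [← h]; simp only [mul_assoc]
        _ = S * (r * R * r) * S := by rw [hrs, hsr, hPS, mul_assoc _ S P, hSP]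
    have h2 : margBC (S * jBC y * S) = y := by
      rw [hY, ← h1, hr, hT.mul_right, hT.mul_left, hy]
    -- `T (S²)` is the support projection of `ρ_B`, on which `y` lives.
    have h3 : margBC (S * S) * y = y := by
      have e1 : margBC A = margB ρ ⊗ₖ 1 := by
        rw [hA]; exact margBC_kronecker _ _
      have e2 : mpow (margB ρ) (-1 / 2) * margB ρ * mpow (margB ρ) (-1 / 2) =
          suppProj (margB ρ) := by
        conv_lhs => enter [1, 2]; rw [← mpow_half_mul_self hB]
        rw [← mul_assoc, mpow_neg_half_mul_half hB, suppProj_mul_mpow _ (by norm_num),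
          mpow_half_mul_neg_half hB]
      rw [hSS, hr, hT.mul_right, hT.mul_left, e1, ← mul_kronecker_mul, ← mul_kronecker_mul, e2,
        one_mul, one_mul, hy, ← mul_assoc, ← mul_assoc, ← mul_kronecker_mul,
        suppProj_mul_mpow _ (by norm_num), one_mul]
    rw [← hY]
    exact hT.commute_of_fixed hS' hy' h3 h2

lemma bsEntropy_sub_eq_zero_iff_isProductChain (hρ : ρ.PosSemidef) {ω : Matrix c c ℂ}
    (hω : ω.PosSemidef) (h : ρ * ampRight (a × b) c (suppProj ω) = ρ) :
    bsEntropy ρ (margAB ρ ⊗ₖ ω) - bsEntropy (margBC ρ) (margB ρ ⊗ₖ ω) = 0 ↔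
      IsProductChain ρ := by
  have hAB := isPartialTrace_margAB.posSemidef hρ
  rw [← isSaturated_iff_isProductChain hρ hω h,
    ← isPartialTrace_margBC.bsEntropy_sub_eq_zero_iff hρ (hAB.kronecker hω)
      (mul_suppProj_margAB_kronecker hρ hω h), margBC_kronecker, traceLeft_margAB]

lemma bsEntropy_sub_eq_zero_iff_isProductChain_rev (hρ : ρ.PosSemidef) {ω : Matrix c c ℂ}
    (hω : ω.PosSemidef) (h : ρ * ampRight (a × b) c (suppProj ω) = ρ)
    (hfin : bsEntropy (margAB ρ ⊗ₖ ω) ρ ≠ ⊤) :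
    bsEntropy (margAB ρ ⊗ₖ ω) ρ - bsEntropy (margB ρ ⊗ₖ ω) (margBC ρ) = 0 ↔
      IsProductChain ρ := by
  have hAB := isPartialTrace_margAB.posSemidef hρ
  have hsymm : IsSaturated (ampBC a b c) margBC ρ (margAB ρ ⊗ₖ ω) ↔
      IsSaturated (ampBC a b c) margBC (margAB ρ ⊗ₖ ω) ρ := ⟨IsSaturated.symm, IsSaturated.symm⟩
  rw [← isSaturated_iff_isProductChain hρ hω h, hsymm,
    ← isPartialTrace_margBC.bsEntropy_sub_eq_zero_iff (hAB.kronecker hω) hρ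
      (mul_suppProj_of_bsEntropy_ne_top hρ hfin), margBC_kronecker, traceLeft_margAB]

lemma isBSQMC_iff_isProductChain (hρ : IsState ρ) (x : Variant)
    (hx : x = Variant.rev → bsEntropy (margAB ρ ⊗ₖ maxMixed c) ρ ≠ ⊤) :
    IsBSQMC x ρ ↔ IsProductChain ρ := by
  have : Nonempty c := nonempty_of_isState hρ
  have hτ : ρ * ampRight (a × b) c (suppProj (maxMixed c)) = ρ := by
    rw [suppProj_maxMixed, map_one, mul_one]
  cases x with
  | os =>
    rw [IsBSQMC, bsCMI]
    exact bsEntropy_sub_eq_zero_iff_isProductChain hρ.1 posSemidef_maxMixed hτ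
  | ts =>
    rw [IsBSQMC, bsCMI]
    exact bsEntropy_sub_eq_zero_iff_isProductChain hρ.1
      (isPartialTrace_margC.posSemidef hρ.1) (isPartialTrace_margC.mul_map_suppProj hρ.1)
  | rev =>
    rw [IsBSQMC, bsCMI]
    exact bsEntropy_sub_eq_zero_iff_isProductChain_rev hρ.1 posSemidef_maxMixed hτ (hx rfl)

end MarkovChain

end BSChain

theorem mainTheorem2 {a b c : Type*} [Fintype a] [Fintype b] [Fintype c]
    [DecidableEq a] [DecidableEq b] [DecidableEq c]
    (ρ : Matrix ((a × b) × c) ((a × b) × c) ℂ) (hρ : BSChain.IsState ρ) :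
    BSChain.IsCompletelyPositive (BSChain.recoveryMap ρ) ∧
    ∀ x : BSChain.Variant,
      (x = BSChain.Variant.rev →
        BSChain.bsEntropy (BSChain.margAB ρ ⊗ₖ BSChain.maxMixed c) ρ ≠ ⊤) →
      (BSChain.IsBSQMC x ρ ↔
        BSChain.tensorId (BSChain.recoveryMap ρ) (BSChain.margBC ρ) = ρ) :=
  ⟨BSChain.isCompletelyPositive_recoveryMap, fun x hx =>
    (BSChain.isBSQMC_iff_isProductChain hρ x hx).trans (BSChain.isProductChain_iff hρ.1)⟩
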